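/- Let $N\ge 2$ be an integer and let $p,q,r,\mu,\sigma,s$ be real numbers. Put $p^*=\frac{Np}{N-p}$ if $p<N$ and $p^*=\infty$ if $p\ge N$, and $p^*(t,\mu)=\frac{p(N-t)}{N-p-\mu}$. Assume $$p>1,\qquad \max\{\sigma,s\}<\mu+p<N,\qquad 1\le q<\min\{p^*,p^*(\sigma,\mu)\},$$ $$\max\Big\{\frac{p(\sigma-s)}{N-\mu-p}+q,\ \frac{\sigma-s}{N-\sigma}\,q+q\Big\}<r<\min\{p^*,p^*(s,\mu)\},$$ $$p(s-\sigma)+q(\mu+p-s)\le r(\mu+p-\sigma),\qquad (Np-Nr+pr)(s-\sigma)\ge (N\mu-Ns+ps)(r-q).$$ For an open set $\Omega\subset\mathbb R^N$ write $|u|_{t,\tau}=\big(\int_\Omega \frac{|u|^t}{|x|^\tau}dx\big)^{1/t}$, let $W_\mu^{1,p}(\Omega)$ be the completion of $C_0^\infty(\Omega)$ with respect to $\|u\|=\big(\int_\Omega\frac{|\nabla u|^p}{|x|^\mu}dx\big)^{1/p}$, regarded as a space of functions on $\Omega$ (almost everywhere limits of sequences of test functions whose gradients converge in $L^p(\Omega,\frac{dx}{|x|^\mu})$,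 the limit being $\nabla u$), and let $E=W_\mu^{1,p}(\Omega)\cap L^q(\Omega,\frac{dx}{|x|^\sigma})$ with the norm $\|u\|_E=\|u\|+\lambda|u|_{q,\sigma}$, where $\lambda>0$. Let $$a=\frac{[(N-\sigma)r-(N-s)q]\,p}{[(N-\sigma)p-(N-\mu-p)q]\,r}.$$ Then: 1. $a\in(0,1)$. 2. There is a constant $C>0$ depending only on $N,p,q,r,\mu,\sigma,s$ such that for every open set $\Omega\subset\mathbb R^N$ and every $u\in E$, $$\Big(\int_\Omega\frac{|u|^r}{|x|^s}dx\Big)^{1/r}\le C\Big(\int_\Omega\frac{|\nabla u|^p}{|x|^\mu}dx\Big)^{a/p}\Big(\int_\Omega\frac{|u|^q}{|x|^\sigma}dx\Big)^{(1-a)/q}.$$ 3. If moreover $r\ge1$, then for every open set $\Omega\subset\mathbb R^N$ and every $\lambda>0$, $E$ is continuously embedded in $L^r(\Omega,\frac{dx}{|x|^s})$: every $u\in E$ belongs to $L^r(\Omega,\frac{dx}{|x|^s})$, and there is a constant $K>0$ with $|u|_{r,s}\le K\|u\|_E$ for all $u\in E$. -/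

import Mathlib

open MeasureTheory Filter Topology
open scoped ENNReal ContDiff

namespace CKN

/-- `N`-dimensional Euclidean space. -/
abbrev Space (N : ℕ) : Type := EuclideanSpace ℝ (Fin N)

/-- The weighted norm `|f|_{r,s} = (∫_Ω |f|^r / |x|^s dx)^(1/r)`, with values in `[0, ∞]`. It is used
for scalar functions and for vector fields, always with `0 < r`. -/
noncomputable def weightedNorm {N : ℕ} {F : Type*} [NormedAddCommGroup F]
    (Ω : Set (Space N)) (r s : ℝ) (f : Space N → F) : ℝ≥0∞ :=
  (∫⁻ x in Ω, ENNReal.ofReal (‖f x‖ ^ r / ‖x‖ ^ s)) ^ (1 / r)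

/-- Membership in the weighted Lebesgue space `L^r(Ω, dx/|x|^s)`. -/
def MemWeightedL {N : ℕ} {F : Type*} [NormedAddCommGroup F]
    (Ω : Set (Space N)) (r s : ℝ) (f : Space N → F) : Prop :=
  AEStronglyMeasurable f (volume.restrict Ω) ∧ weightedNorm Ω r s f < ⊤

/-- `φ ∈ C_0^∞(Ω)`. -/
def IsTestFunction {N : ℕ} (Ω : Set (Space N)) (φ : Space N → ℝ) : Prop :=
  ContDiff ℝ ∞ φ ∧ HasCompactSupport φ ∧ tsupport φ ⊆ Ω

/-- `MemW Ω p μ u G`: the function `u` belongs to the space `W_μ^{1,p}(Ω)`, the completion of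
`C_0^∞(Ω)` for the norm `‖φ‖ = (∫_Ω |∇φ|^p / |x|^μ dx)^(1/p)`, and `G` is its gradient.

An element of the completion is given by a sequence of test functions whose gradients are Cauchy,
hence convergent to some field `G`, in the complete space `L^p(Ω, dx/|x|^μ; ℝ^N)`. As a function it
is the pointwise almost everywhere limit `u` of such a sequence. The norm of the
element is `weightedNorm Ω p μ G`. (For `1 < p` and `μ + p < N` the weighted Hardy inequality shows
that every element of the completion is represented by a function in this way, and
that `u` and `G` determine each other up to null sets.) -/
def MemW {N : ℕ} (Ω : Set (Space N)) (p μ : ℝ) (u : Space N → ℝ) (G : Space N → Space N) : Prop :=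
  MemWeightedL Ω p μ G ∧
  ∃ φ : ℕ → Space N → ℝ, (∀ n, IsTestFunction Ω (φ n)) ∧
    Tendsto (fun n => weightedNorm Ω p μ (fun x => gradient (φ n) x - G x)) atTop (𝓝 0) ∧
    ∀ᵐ x ∂(volume.restrict Ω), Tendsto (fun n => φ n x) atTop (𝓝 (u x))

/-- `u ∈ E = W_μ^{1,p}(Ω) ∩ L^q(Ω, dx/|x|^σ)`, with gradient `G`. -/
def MemE {N : ℕ} (Ω : Set (Space N)) (p q μ σ : ℝ) (u : Space N → ℝ) (G : Space N → Space N) :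
    Prop :=
  MemW Ω p μ u G ∧ MemWeightedL Ω q σ u

/-- The norm `‖u‖_E = ‖u‖ + lam * |u|_{q,σ}` of an element of `E` with gradient `G`. -/
noncomputable def normE {N : ℕ} (Ω : Set (Space N)) (p q μ σ lam : ℝ) (u : Space N → ℝ)
    (G : Space N → Space N) : ℝ≥0∞ :=
  weightedNorm Ω p μ G + ENNReal.ofReal lam * weightedNorm Ω q σ u

/-- The critical Sobolev exponent `p^*`: it is `Np/(N-p)` for `p < N`, and `∞` for `N ≤ p`. -/
noncomputable def pStar (N : ℕ) (p : ℝ) : EReal :=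
  open Classical in if p < N then ((N * p / (N - p) : ℝ) : EReal) else ⊤

/-- The weighted critical exponent `p^*(s, μ) = p(N-s)/(N-p-μ)`. -/
noncomputable def pStarW (N : ℕ) (p s μ : ℝ) : ℝ := p * (N - s) / (N - p - μ)

/-- The interpolation exponent `a`. -/
noncomputable def cknA (N : ℕ) (p q r μ σ s : ℝ) : ℝ :=
  (((N - σ) * r - (N - s) * q) * p) / (((N - σ) * p - (N - μ - p) * q) * r)

end CKN

/-! The inequality is an interpolation governed by one parameter `k`, defined by `1/r = (1-a)/q +
a(1/p - k/N)`; the value of `a` then forces the analogous balance of the weights. The last two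
hypotheses of the theorem say `0 ≤ k` and `k ≤ 1`: `k = 0` is the Hardy end, `k = 1` the Sobolev
end.

Everything reduces to `L¹`. Integration along rays gives the weighted Hardy inequality `hardy_one`;
the `L¹` Sobolev inequality for `|x|^(-b) V`, with Hardy controlling the derivative of the weight,
gives `sobolev_one`; Hölder between them gives `hardySobolev_one`. Applying this to `|w|^γ` and
using Hölder on `γ |w|^(γ-1) |∇w|` gives a family of inequalities with `γ` free. One of two choices
of `γ`, followed by interpolation or absorption, yields `ckn_away_from_zero`.

For `u` in `E`, the test functions `φ n` converge to `u` in gradient and almost everywhere, but need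
not converge in the weighted `L^q`. They are therefore replaced by `η j * trunc (j+1) (φ n)`, with
`η j` a cutoff away from `0` and infinity: for fixed `j` the `L^q` integrals converge by domination,
and by Hardy the gradient norms are bounded independently of `j`, up to a constant factor. Fatou in
`n`, then in `j`, concludes. -/

namespace CKN

/-! ### Weighted integrals: Hölder interpolation and scaling -/

/-- The weighted integral `∫ |f|^r / |x|^s dν`. -/
noncomputable def wInt {N : ℕ} {F : Type*} [NormedAddCommGroup F]
    (ν : Measure (Space N)) (r s : ℝ) (f : Space N → F) : ℝ≥0∞ :=
  ∫⁻ x, ENNReal.ofReal (‖f x‖ ^ r / ‖x‖ ^ s) ∂ν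

theorem weightedNorm_eq {N : ℕ} {F : Type*} [NormedAddCommGroup F]
    (Ω : Set (Space N)) (r s : ℝ) (f : Space N → F) :
    weightedNorm Ω r s f = wInt (volume.restrict Ω) r s f ^ (1 / r) := rfl

theorem ae_ne_zero {N : ℕ} (hN : 2 ≤ N) : ∀ᵐ x : Space N, x ≠ 0 := by
  have : Nontrivial (Space N) := by
    apply Module.nontrivial_of_finrank_pos (R := ℝ)
    simp; omega
  exact (volume : Measure (Space N)).ae_ne 0

/-- Hölder with exponents `1/α`, `1/β`: off the origin the integrand is a product of powers of the
two others, so the exponent and the weight interpolate linearly with the same coefficients. -/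
theorem wInt_interpolation {N : ℕ} {F : Type*} [NormedAddCommGroup F]
    (hN : 2 ≤ N) {f : Space N → F} (hf : Continuous f) {r r₀ r₁ s s₀ s₁ α β : ℝ}
    (hr₀ : 0 < r₀) (hr₁ : 0 < r₁) (hα : 0 ≤ α) (hβ : 0 ≤ β) (hαβ : α + β = 1)
    (hr : r = α * r₀ + β * r₁) (hs : s = α * s₀ + β * s₁) :
    wInt volume r s f ≤ wInt volume r₀ s₀ f ^ α * wInt volume r₁ s₁ f ^ β := by
  refine le_trans (le_of_eq ?_) (ENNReal.lintegral_mul_norm_pow_le ?_ ?_ hα hβ hαβ)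
  · refine lintegral_congr_ae ?_
    filter_upwards [ae_ne_zero hN] with x hx
    have hx' : 0 < ‖x‖ := norm_pos_iff.2 hx
    rw [ENNReal.ofReal_rpow_of_nonneg (by positivity) hα,
      ENNReal.ofReal_rpow_of_nonneg (by positivity) hβ, ← ENNReal.ofReal_mul (by positivity)]
    congr 1
    rw [Real.div_rpow (by positivity) (by positivity), Real.div_rpow (by positivity) (by positivity),
      ← Real.rpow_mul (by positivity), ← Real.rpow_mul (by positivity),
      ← Real.rpow_mul (by positivity), ← Real.rpow_mul (by positivity), div_mul_div_comm,
      ← Real.rpow_add hx', ← Real.rpow_add_of_nonneg (by positivity) (by positivity) (by positivity),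
      hr, hs]
    congr 2 <;> ring
  · exact ((hf.norm.measurable.pow_const _).div (measurable_norm.pow_const _)).ennreal_ofReal.aemeasurable
  · exact ((hf.norm.measurable.pow_const _).div (measurable_norm.pow_const _)).ennreal_ofReal.aemeasurable

theorem lintegral_comp_smul {N : ℕ} (h : Space N → ℝ≥0∞) {t : ℝ} (ht : 0 < t) :
    ∫⁻ x, h (t • x) = ENNReal.ofReal (t ^ (-(N : ℝ))) * ∫⁻ x, h x := by
  have h1 : ∫⁻ x, h x ∂(Measure.map (t • ·) (volume : Measure (Space N))) = ∫⁻ x, h (t • x) :=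
    lintegral_map_equiv h (Homeomorph.smul (isUnit_iff_ne_zero.2 ht.ne').unit).toMeasurableEquiv
  rw [← h1, Measure.map_addHaar_smul _ ht.ne', lintegral_smul_measure, smul_eq_mul]
  congr 2
  rw [abs_of_nonneg (by positivity), Real.rpow_neg ht.le, finrank_euclideanSpace_fin,
    Real.rpow_natCast]

/-! ### Hardy and Sobolev inequalities in `L¹` -/

/-- Fundamental theorem of calculus on the ray `t • x`, `t ≥ 1`, at whose far end `V` vanishes. The
parameter is `y = -t`, so the half-line is `Iic (-1)`. -/
theorem enorm_le_lintegral_ray {N : ℕ} {V : Space N → ℝ} (hV : ContDiff ℝ 1 V)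
    (hc : HasCompactSupport V) {x : Space N} (hx : x ≠ 0) :
    ‖V x‖ₑ ≤ ∫⁻ y in Set.Iic (-1 : ℝ), ‖fderiv ℝ V ((-y) • x)‖ₑ * ‖x‖ₑ := by
  have hg : ContDiff ℝ 1 (fun y : ℝ => V ((-y) • x)) := by fun_prop
  have hemb : IsClosedEmbedding (fun y : ℝ => (-y) • x) :=
    (isClosedEmbedding_smul_left hx).comp (Homeomorph.neg ℝ).isClosedEmbedding
  have hgc : HasCompactSupport (fun y : ℝ => V ((-y) • x)) := hc.comp_isClosedEmbedding hemb
  have := hgc.enorm_le_lintegral_Ici_deriv hg (-1)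
  simp only [neg_neg, one_smul] at this
  refine this.trans (lintegral_mono fun y => ?_)
  have hd : HasDerivAt (fun y : ℝ => V ((-y) • x)) (fderiv ℝ V ((-y) • x) ((-1 : ℝ) • x)) y := by
    have h1 : HasDerivAt (fun y : ℝ => (-y) • x) ((-1 : ℝ) • x) y :=
      (hasDerivAt_neg y).smul_const x
    exact ((hV.differentiable one_ne_zero) _).hasFDerivAt.comp_hasDerivAt y h1
  rw [hd.deriv]
  refine ((fderiv ℝ V ((-y) • x)).le_opENorm _).trans ?_
  simp

/-- Integrate the ray bound against `|x|^(-b)`, exchange the integrals and substitute `z = t • x`: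
the factor `t^(b-N)` comes out, integrable on `[1, ∞)` because `b + 1 < N`. -/
theorem hardy_one {N : ℕ} (hN : 2 ≤ N) {b : ℝ} (hb : b + 1 < N) :
    ∃ C : NNReal, ∀ V : Space N → ℝ, ContDiff ℝ 1 V → HasCompactSupport V →
      wInt volume 1 (b + 1) V ≤ C * wInt volume 1 b (fderiv ℝ V) := by
  have hint : IntegrableOn (fun y : ℝ => (-y) ^ (b - N)) (Set.Iic (-1)) := by
    have := integrableOn_Ioi_rpow_of_lt (a := b - N) (c := 1) (by linarith) one_pos
    rw [← integrableOn_Ici_iff_integrableOn_Ioi (by finiteness)] at this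
    rw [← neg_neg (1 : ℝ)] at this
    exact this.comp_neg_Iic
  have hfin : ∫⁻ y in Set.Iic (-1 : ℝ), ENNReal.ofReal ((-y) ^ (b - N)) ≠ ⊤ := by
    exact hint.lintegral_lt_top.ne
  refine ⟨(∫⁻ y in Set.Iic (-1 : ℝ), ENNReal.ofReal ((-y) ^ (b - N))).toNNReal,
    fun V hV hc => ?_⟩
  rw [ENNReal.coe_toNNReal hfin]
  have hDc : Continuous (fderiv ℝ V) := hV.continuous_fderiv one_ne_zero
  calc wInt volume 1 (b + 1) V
      ≤ ∫⁻ x : Space N, ∫⁻ y in Set.Iic (-1 : ℝ),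
          ‖fderiv ℝ V ((-y) • x)‖ₑ * ENNReal.ofReal (1 / ‖x‖ ^ b) := by
        refine lintegral_mono_ae ?_
        filter_upwards [ae_ne_zero hN] with x hx
        have hx' : 0 < ‖x‖ := norm_pos_iff.2 hx
        have h1 : ENNReal.ofReal (‖V x‖ ^ (1 : ℝ) / ‖x‖ ^ (b + 1)) =
            ‖V x‖ₑ * ENNReal.ofReal (1 / ‖x‖ ^ (b + 1)) := by
          rw [← ofReal_norm, ← ENNReal.ofReal_mul (norm_nonneg _), Real.rpow_one]
          congr 1; ring
        rw [h1]
        refine (mul_le_mul_left (enorm_le_lintegral_ray hV hc hx) _).trans (le_of_eq ?_)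
        rw [← lintegral_mul_const' _ _ ENNReal.ofReal_ne_top]
        refine lintegral_congr fun y => ?_
        rw [mul_assoc, ← ofReal_norm x, ← ENNReal.ofReal_mul (norm_nonneg _)]
        congr 2
        rw [Real.rpow_add hx', Real.rpow_one]
        field_simp
    _ = ∫⁻ y in Set.Iic (-1 : ℝ), ∫⁻ x : Space N,
          ‖fderiv ℝ V ((-y) • x)‖ₑ * ENNReal.ofReal (1 / ‖x‖ ^ b) := by
        refine lintegral_lintegral_swap (Measurable.aemeasurable ?_)
        change Measurable fun z : Space N × ℝ =>
          ‖fderiv ℝ V ((-z.2) • z.1)‖ₑ * ENNReal.ofReal (1 / ‖z.1‖ ^ b)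
        refine Measurable.fun_mul ?_ ?_
        · have : Continuous fun z : Space N × ℝ => fderiv ℝ V ((-z.2) • z.1) := by fun_prop
          exact this.enorm.measurable
        · exact ((measurable_const).div ((measurable_norm.comp measurable_fst).pow_const _)).ennreal_ofReal
    _ = ∫⁻ y in Set.Iic (-1 : ℝ), ENNReal.ofReal ((-y) ^ (b - N)) *
          wInt volume 1 b (fderiv ℝ V) := by
        refine setLIntegral_congr_fun measurableSet_Iic fun y hy => ?_
        have ht : 0 < -y := by simp at hy; linarith
        generalize -y = t at ht
        have h1 : ∀ x : Space N, ‖fderiv ℝ V (t • x)‖ₑ * ENNReal.ofReal (1 / ‖x‖ ^ b) =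
            (fun z => ENNReal.ofReal (t ^ b) *
              ENNReal.ofReal (‖fderiv ℝ V z‖ ^ (1 : ℝ) / ‖z‖ ^ b)) (t • x) := by
          intro x
          beta_reduce
          rw [← ofReal_norm, ← ENNReal.ofReal_mul (norm_nonneg _),
            ← ENNReal.ofReal_mul (by positivity), norm_smul, Real.norm_of_nonneg ht.le,
            Real.mul_rpow ht.le (norm_nonneg _), Real.rpow_one]
          congr 1
          have := Real.rpow_pos_of_pos ht b
          field_simp
        refine (lintegral_congr h1).trans ((lintegral_comp_smul
          (fun z => ENNReal.ofReal (t ^ b) *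
            ENNReal.ofReal (‖fderiv ℝ V z‖ ^ (1 : ℝ) / ‖z‖ ^ b)) ht).trans ?_)
        rw [lintegral_const_mul' _ _ ENNReal.ofReal_ne_top, ← mul_assoc,
          ← ENNReal.ofReal_mul (by positivity), ← Real.rpow_add ht, wInt]
        congr 3; ring
    _ = _ := by
        rw [lintegral_mul_const]
        exact ((measurable_neg.pow_const _)).ennreal_ofReal

theorem contDiff_norm_rpow_mul {N : ℕ} {V : Space N → ℝ} (hV : ContDiff ℝ 1 V)
    (h0 : (0 : Space N) ∉ tsupport V) (c : ℝ) : ContDiff ℝ 1 (fun x => ‖x‖ ^ c * V x) := by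
  rw [contDiff_iff_contDiffAt]
  intro x
  by_cases hx : x = 0
  · subst hx
    have h1 : (fun x => ‖x‖ ^ c * V x) =ᶠ[𝓝 (0 : Space N)] fun _ => 0 := by
      filter_upwards [notMem_tsupport_iff_eventuallyEq.1 h0] with y hy
      simp [hy]
    exact contDiffAt_const.congr_of_eventuallyEq h1
  · exact ((contDiffAt_norm ℝ hx).rpow_const_of_ne (norm_ne_zero_iff.2 hx)).mul hV.contDiffAt

theorem norm_fderiv_norm_rpow_mul_le {N : ℕ} {V : Space N → ℝ} (hV : ContDiff ℝ 1 V) (c : ℝ)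
    {x : Space N} (hx : x ≠ 0) :
    ‖fderiv ℝ (fun x => ‖x‖ ^ c * V x) x‖ ≤
      ‖x‖ ^ c * ‖fderiv ℝ V x‖ + |c| * (‖x‖ ^ (c - 1) * ‖V x‖) := by
  have hn : HasFDerivAt (fun x : Space N => ‖x‖) (fderiv ℝ (fun x : Space N => ‖x‖) x) x :=
    ((contDiffAt_norm ℝ hx (n := 1)).differentiableAt one_ne_zero).hasFDerivAt
  have hle : ‖fderiv ℝ (fun x : Space N => ‖x‖) x‖ ≤ 1 := by
    simpa using norm_fderiv_le_of_lipschitz ℝ (lipschitzWith_one_norm (E := Space N)) (x₀ := x)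
  have h1 := (hn.rpow_const (p := c) (Or.inl (norm_ne_zero_iff.2 hx))).fun_mul
    (hV.differentiable one_ne_zero x).hasFDerivAt
  rw [HasFDerivAt.fderiv h1]
  refine (norm_add_le _ _).trans ?_
  rw [norm_smul, norm_smul, norm_smul, Real.norm_of_nonneg (by positivity : 0 ≤ ‖x‖ ^ c),
    norm_mul, Real.norm_of_nonneg (by positivity : 0 ≤ ‖x‖ ^ (c - 1)), Real.norm_eq_abs c]
  refine add_le_add le_rfl ?_
  calc ‖V x‖ * (|c| * ‖x‖ ^ (c - 1) * ‖fderiv ℝ (fun x : Space N => ‖x‖) x‖)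
      ≤ ‖V x‖ * (|c| * ‖x‖ ^ (c - 1) * 1) := by gcongr
    _ = _ := by ring

/-- Unweighted Sobolev for `|x|^(-b) V`. The derivative of the weight contributes `|b| |V| /
|x|^(b+1)`, which `hardy_one` bounds by the gradient term. Vanishing near `0` keeps the product
`C¹`. -/
theorem sobolev_one {N : ℕ} (hN : 2 ≤ N) {b : ℝ} (hb : b + 1 < N) :
    ∃ C : NNReal, ∀ V : Space N → ℝ, ContDiff ℝ 1 V → HasCompactSupport V → 0 ∉ tsupport V →
      wInt volume (N / (N - 1)) (N / (N - 1) * b) V ≤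
        C * wInt volume 1 b (fderiv ℝ V) ^ ((N : ℝ) / (N - 1)) := by
  obtain ⟨C, hC⟩ := hardy_one hN hb
  have hN1 : (1 : ℝ) < N := by exact_mod_cast (by omega : 1 < N)
  have hconj : Real.HolderConjugate (Module.finrank ℝ (Space N)) (N / (N - 1)) := by
    rw [finrank_euclideanSpace_fin]
    exact Real.HolderConjugate.conjExponent hN1
  have hκ : (0 : ℝ) ≤ N / (N - 1) := div_nonneg (by linarith) (by linarith)
  refine ⟨lintegralPowLePowLIntegralFDerivConst (volume : Measure (Space N)) (N / (N - 1)) *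
    (1 + Real.nnabs b * C) ^ ((N : ℝ) / (N - 1)), fun V hV hc h0 => ?_⟩
  have hU := contDiff_norm_rpow_mul hV h0 (-b)
  have hUc : HasCompactSupport (fun x => ‖x‖ ^ (-b) * V x) := hc.mul_left
  have hDV : Continuous (fderiv ℝ V) := hV.continuous_fderiv one_ne_zero
  have hS := lintegral_pow_le_pow_lintegral_fderiv (volume : Measure (Space N)) hU hUc hconj
  have hL : wInt volume (N / (N - 1)) (N / (N - 1) * b) V =
      ∫⁻ x : Space N, ‖‖x‖ ^ (-b) * V x‖ₑ ^ ((N : ℝ) / (N - 1)) := by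
    refine lintegral_congr_ae ?_
    filter_upwards [ae_ne_zero hN] with x hx
    have hx' : 0 < ‖x‖ := norm_pos_iff.2 hx
    rw [← ofReal_norm, ENNReal.ofReal_rpow_of_nonneg (norm_nonneg _) hκ, norm_mul,
      Real.mul_rpow (norm_nonneg _) (norm_nonneg _), Real.norm_of_nonneg (by positivity : 0 ≤ ‖x‖ ^ (-b)),
      ← Real.rpow_mul hx'.le, div_eq_mul_inv, ← Real.rpow_neg hx'.le, mul_comm (‖V x‖ ^ _)]
    congr 3
    ring
  have hR : ∫⁻ x : Space N, ‖fderiv ℝ (fun x => ‖x‖ ^ (-b) * V x) x‖ₑ ≤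
      (1 + Real.nnabs b * C : NNReal) * wInt volume 1 b (fderiv ℝ V) := by
    calc ∫⁻ x : Space N, ‖fderiv ℝ (fun x => ‖x‖ ^ (-b) * V x) x‖ₑ
        ≤ ∫⁻ x : Space N, (ENNReal.ofReal (‖fderiv ℝ V x‖ ^ (1 : ℝ) / ‖x‖ ^ b) +
            Real.nnabs b * ENNReal.ofReal (‖V x‖ ^ (1 : ℝ) / ‖x‖ ^ (b + 1))) := by
          refine lintegral_mono_ae ?_
          filter_upwards [ae_ne_zero hN] with x hx
          have hx' : 0 < ‖x‖ := norm_pos_iff.2 hx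
          have hnn : (Real.nnabs b : ℝ≥0∞) = ENNReal.ofReal |b| := by
            rw [ENNReal.ofReal, Real.nnabs]; congr 1; exact (Real.toNNReal_of_nonneg (abs_nonneg b)).symm
          rw [hnn, ← ENNReal.ofReal_mul (abs_nonneg b), ← ENNReal.ofReal_add (by positivity)
            (by positivity), ← ofReal_norm]
          refine ENNReal.ofReal_le_ofReal
            ((norm_fderiv_norm_rpow_mul_le hV (-b) hx).trans (le_of_eq ?_))
          rw [abs_neg, Real.rpow_one, Real.rpow_one, div_eq_mul_inv, div_eq_mul_inv,
            ← Real.rpow_neg hx'.le, ← Real.rpow_neg hx'.le, show -b - 1 = -(b + 1) by ring]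
          ring
      _ = wInt volume 1 b (fderiv ℝ V) + Real.nnabs b * wInt volume 1 (b + 1) V := by
          rw [lintegral_add_left, lintegral_const_mul' _ _ ENNReal.coe_ne_top, wInt, wInt]
          exact ((hDV.norm.measurable.pow_const _).div
            (measurable_norm.pow_const _)).ennreal_ofReal
      _ ≤ wInt volume 1 b (fderiv ℝ V) +
            Real.nnabs b * (C * wInt volume 1 b (fderiv ℝ V)) := by
          gcongr; exact hC V hV hc
      _ = _ := by push_cast; ring
  rw [hL]
  refine hS.trans ((mul_le_mul_right (ENNReal.rpow_le_rpow hR hκ) _).trans (le_of_eq ?_))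
  rw [ENNReal.mul_rpow_of_nonneg _ _ hκ, ← mul_assoc, ENNReal.coe_mul,
    ENNReal.coe_rpow_of_nonneg _ hκ]

/-- The `L¹` Hardy-Sobolev inequality, for functions vanishing near the origin. -/
theorem hardySobolev_one {N : ℕ} (hN : 2 ≤ N) {b k κ : ℝ} (hb : b + 1 < N) (hk0 : 0 ≤ k)
    (hk1 : k ≤ 1) (hκ : κ = N / (N - k)) :
    ∃ C : NNReal, ∀ V : Space N → ℝ, ContDiff ℝ 1 V → HasCompactSupport V → 0 ∉ tsupport V →
      wInt volume κ (κ * (b + 1 - k)) V ≤ C * wInt volume 1 b (fderiv ℝ V) ^ κ := by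
  obtain ⟨C₀, h₀⟩ := hardy_one hN hb
  obtain ⟨C₁, h₁⟩ := sobolev_one hN hb
  have hN2 : (2 : ℝ) ≤ N := by exact_mod_cast hN
  have hN1 : (0 : ℝ) < N - 1 := by linarith
  have hNk : (0 : ℝ) < N - k := by linarith
  have hα : 0 ≤ (1 - k) * κ := by
    rw [hκ]; exact mul_nonneg (by linarith) (div_nonneg (by linarith) hNk.le)
  have hβ : 0 ≤ k * (N - 1) / (N - k) := div_nonneg (by positivity) hNk.le
  refine ⟨C₀ ^ ((1 - k) * κ) * C₁ ^ (k * (N - 1) / (N - k)), fun V hV hc h0 => ?_⟩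
  have hi := wInt_interpolation hN hV.continuous (r := κ) (r₀ := 1) (r₁ := N / (N - 1))
    (s := κ * (b + 1 - k)) (s₀ := b + 1) (s₁ := N / (N - 1) * b) one_pos (by positivity)
    hα hβ (by rw [hκ]; field_simp; ring) (by rw [hκ]; field_simp; ring)
    (by rw [hκ]; field_simp; ring)
  refine hi.trans ((mul_le_mul' (ENNReal.rpow_le_rpow (h₀ V hV hc) hα)
    (ENNReal.rpow_le_rpow (h₁ V hV hc h0) hβ)).trans (le_of_eq ?_))
  rw [ENNReal.mul_rpow_of_nonneg _ _ hα, ENNReal.mul_rpow_of_nonneg _ _ hβ, ← ENNReal.rpow_mul,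
    mul_mul_mul_comm, ← ENNReal.rpow_add_of_nonneg _ _ hα (by positivity), ENNReal.coe_mul,
    ENNReal.coe_rpow_of_nonneg _ hα, ENNReal.coe_rpow_of_nonneg _ hβ]
  congr 2
  rw [hκ]; field_simp; ring

/-! ### From `L¹` to `L^p`: powers of a function -/

theorem wInt_norm_rpow {N : ℕ} {F : Type*} [NormedAddCommGroup F] (ν : Measure (Space N))
    (r s γ : ℝ) (w : Space N → F) :
    wInt ν r s (fun x => ‖w x‖ ^ γ) = wInt ν (r * γ) s w := by
  refine lintegral_congr fun x => ?_
  rw [Real.norm_of_nonneg (by positivity), ← Real.rpow_mul (norm_nonneg _), mul_comm γ]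

/-- Chain rule `|∇|w|^γ| ≤ γ |w|^(γ-1) |∇w|`, then Hölder with `p` and its conjugate; `m` and `τ`
are the exponent and weight left on the factor without gradient. -/
theorem wInt_fderiv_norm_rpow_le {N : ℕ} (hN : 2 ≤ N) {w : Space N → ℝ} (hw : ContDiff ℝ 1 w)
    {p μ γ b m τ : ℝ} (hp : 1 < p) (hγ : 1 < γ) (hm : m * (1 - 1 / p) = γ - 1)
    (hτ : τ * (1 - 1 / p) = b - μ / p) :
    wInt volume 1 b (fderiv ℝ (fun x => ‖w x‖ ^ γ)) ≤
      ENNReal.ofReal γ *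
        (wInt volume p μ (fderiv ℝ w) ^ (1 / p) * wInt volume m τ w ^ (1 - 1 / p)) := by
  have hp0 : 0 < p := by linarith
  have hp' : 0 ≤ 1 - 1 / p := by
    rw [sub_nonneg, div_le_one hp0]; exact hp.le
  have hD : Continuous (fderiv ℝ w) := hw.continuous_fderiv one_ne_zero
  calc wInt volume 1 b (fderiv ℝ (fun x => ‖w x‖ ^ γ))
      ≤ ∫⁻ x : Space N, ENNReal.ofReal γ *
          (ENNReal.ofReal (‖fderiv ℝ w x‖ ^ p / ‖x‖ ^ μ) ^ (1 / p) *
            ENNReal.ofReal (‖w x‖ ^ m / ‖x‖ ^ τ) ^ (1 - 1 / p)) := by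
        refine lintegral_mono_ae ?_
        filter_upwards [ae_ne_zero hN] with x hx
        have hx' : 0 < ‖x‖ := norm_pos_iff.2 hx
        rw [ENNReal.ofReal_rpow_of_nonneg (by positivity) (by positivity),
          ENNReal.ofReal_rpow_of_nonneg (by positivity) hp', ← ENNReal.ofReal_mul (by positivity),
          ← ENNReal.ofReal_mul (by positivity)]
        refine ENNReal.ofReal_le_ofReal ?_
        rw [Real.div_rpow (by positivity) (by positivity),
          Real.div_rpow (by positivity) (by positivity),
          ← Real.rpow_mul (by positivity), ← Real.rpow_mul (by positivity),
          ← Real.rpow_mul (by positivity), ← Real.rpow_mul (by positivity), hm, hτ,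
          mul_one_div_cancel hp0.ne', div_mul_div_comm, ← Real.rpow_add hx', Real.rpow_one,
          Real.rpow_one, show μ * (1 / p) + (b - μ / p) = b by ring, ← mul_div_assoc]
        gcongr
        refine (norm_fderiv_norm_rpow_le (hw.differentiable one_ne_zero) hγ).trans (le_of_eq ?_)
        ring
    _ ≤ _ := by
        rw [lintegral_const_mul' _ _ ENNReal.ofReal_ne_top]
        gcongr
        refine ENNReal.lintegral_mul_norm_pow_le ?_ ?_ (by positivity) hp' (by ring)
        · exact ((hD.norm.measurable.pow_const _).div
            (measurable_norm.pow_const _)).ennreal_ofReal.aemeasurable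
        · exact ((hw.continuous.norm.measurable.pow_const _).div
            (measurable_norm.pow_const _)).ennreal_ofReal.aemeasurable

theorem hasCompactSupport_norm_rpow {N : ℕ} {w : Space N → ℝ} (hc : HasCompactSupport w)
    {γ : ℝ} (hγ : γ ≠ 0) : HasCompactSupport (fun x => ‖w x‖ ^ γ) :=
  hc.comp_left (g := fun t : ℝ => ‖t‖ ^ γ) (by simp [hγ])

theorem hardySobolev_rpow {N : ℕ} (hN : 2 ≤ N) {p μ γ b k κ m τ : ℝ} (hp : 1 < p)
    (hγ : 1 < γ) (hb : b + 1 < N) (hk0 : 0 ≤ k) (hk1 : k ≤ 1) (hκ : κ = N / (N - k))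
    (hm : m * (1 - 1 / p) = γ - 1) (hτ : τ * (1 - 1 / p) = b - μ / p) :
    ∃ C : NNReal, ∀ w : Space N → ℝ, ContDiff ℝ 1 w → HasCompactSupport w → 0 ∉ tsupport w →
      wInt volume (κ * γ) (κ * (b + 1 - k)) w ≤
        C * (wInt volume p μ (fderiv ℝ w) ^ (1 / p) * wInt volume m τ w ^ (1 - 1 / p)) ^ κ := by
  obtain ⟨C, hC⟩ := hardySobolev_one hN hb hk0 hk1 hκ
  have hN2 : (2 : ℝ) ≤ N := by exact_mod_cast hN
  have hκ0 : 0 ≤ κ := by rw [hκ]; exact div_nonneg (by linarith) (by linarith)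
  refine ⟨C * γ.toNNReal ^ κ, fun w hw hc h0 => ?_⟩
  have ht : tsupport (fun x => ‖w x‖ ^ γ) ⊆ tsupport w := by
    refine closure_mono fun x hx => ?_
    simp only [Function.mem_support] at hx ⊢
    intro h
    apply hx
    rw [h, norm_zero, Real.zero_rpow (by linarith)]
  have h1 := hC _ (hw.norm_rpow hγ) (hasCompactSupport_norm_rpow hc (by linarith))
    (fun h => h0 (ht h))
  rw [wInt_norm_rpow] at h1
  refine h1.trans ((mul_le_mul_right (ENNReal.rpow_le_rpow
    (wInt_fderiv_norm_rpow_le hN hw hp hγ hm hτ) hκ0) _).trans (le_of_eq ?_))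
  rw [ENNReal.mul_rpow_of_nonneg _ _ hκ0, ← mul_assoc, ENNReal.coe_mul,
    ENNReal.coe_rpow_of_nonneg _ hκ0, ENNReal.ofReal]

theorem lintegral_weight_lt_top {N : ℕ} (hN : 2 ≤ N) {τ : ℝ} (hτ : τ < N) {K : Set (Space N)}
    (hK : IsCompact K) : ∫⁻ x in K, ENNReal.ofReal (1 / ‖x‖ ^ τ) < ⊤ := by
  have h : LocallyIntegrable (fun x : Space N => 1 / ‖x‖ ^ τ) volume := by
    refine locallyIntegrable_of_norm_le_rpow (C := 1) (α := τ) ?_ ?_ ?_ ?_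
    · rw [finrank_euclideanSpace_fin]; omega
    · rwa [finrank_euclideanSpace_fin]
    · refine ae_of_all _ fun x => ?_
      rw [Real.norm_of_nonneg (by positivity), Real.rpow_neg (norm_nonneg _), one_mul, one_div]
    · exact (measurable_const.div (measurable_norm.pow_const _)).aestronglyMeasurable
  exact (h.integrableOn_isCompact hK).lintegral_lt_top

theorem wInt_lt_top {N : ℕ} (hN : 2 ≤ N) {F : Type*} [NormedAddCommGroup F] {r τ : ℝ} (hr : 0 < r)
    (hτ : τ < N) {w : Space N → F} (hw : Continuous w) (hc : HasCompactSupport w) :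
    wInt volume r τ w < ⊤ := by
  obtain ⟨M, hM⟩ := hw.bounded_above_of_compact_support hc
  have hM0 : 0 ≤ M := (norm_nonneg _).trans (hM 0)
  have h1 : wInt volume r τ w ≤
      ∫⁻ x in tsupport w, ENNReal.ofReal (M ^ r) * ENNReal.ofReal (1 / ‖x‖ ^ τ) := by
    rw [← lintegral_indicator (isClosed_tsupport w).measurableSet]
    refine lintegral_mono fun x => ?_
    by_cases hx : x ∈ tsupport w
    · rw [Set.indicator_of_mem hx, ← ENNReal.ofReal_mul (by positivity), mul_one_div]
      refine ENNReal.ofReal_le_ofReal ?_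
      have := hM x
      gcongr
    · rw [image_eq_zero_of_notMem_tsupport hx]
      simp [Real.zero_rpow hr.ne']
  refine h1.trans_lt ?_
  rw [lintegral_const_mul' _ _ ENNReal.ofReal_ne_top]
  exact ENNReal.mul_lt_top ENNReal.ofReal_lt_top (lintegral_weight_lt_top hN hτ hc)

/-- Absorption: dividing by `R ^ e` requires `R` finite, which `wInt_lt_top` supplies for compactly
supported functions. -/
theorem rpow_one_sub_le {R A : ℝ≥0∞} {e : ℝ} (he : e < 1) (hR : R ≠ ⊤) (h : R ≤ A * R ^ e) :
    R ^ (1 - e) ≤ A := by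
  rcases eq_or_ne R 0 with rfl | h0
  · rw [ENNReal.zero_rpow_of_pos (by linarith)]; exact zero_le
  · rw [ENNReal.rpow_sub _ _ h0 hR, ENNReal.rpow_one]
    exact ENNReal.div_le_of_le_mul h

/-- The weighted Hardy inequality. -/
theorem hardy {N : ℕ} (hN : 2 ≤ N) {p μ : ℝ} (hp : 1 < p) (hμ : μ + p < N) :
    ∃ C : NNReal, ∀ φ : Space N → ℝ, ContDiff ℝ 1 φ → HasCompactSupport φ →
      wInt volume p (μ + p) φ ^ (1 / p) ≤ C * wInt volume p μ (fderiv ℝ φ) ^ (1 / p) := by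
  have hp0 : 0 < p := by linarith
  obtain ⟨C, hC⟩ := hardy_one hN (b := μ + p - 1) (by linarith)
  refine ⟨C * p.toNNReal, fun φ hφ hc => ?_⟩
  have h1 := hC _ (hφ.norm_rpow hp) (hasCompactSupport_norm_rpow hc hp0.ne')
  rw [wInt_norm_rpow, one_mul, sub_add_cancel] at h1
  -- With `γ = p` the Hölder factor is the left side itself, to the power `1 - 1/p`, and can be
  -- absorbed.
  have h2 := h1.trans (mul_le_mul_right (wInt_fderiv_norm_rpow_le hN hφ (μ := μ) (m := p)
    (τ := μ + p) hp hp (by field_simp) (by field_simp; ring)) _)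
  rw [← mul_assoc, ← mul_assoc] at h2
  have h3 := rpow_one_sub_le (by rw [sub_lt_self_iff]; positivity)
    (wInt_lt_top hN hp0 hμ hφ.continuous hc).ne h2
  rwa [sub_sub_cancel] at h3

/-! ### The inequality for functions vanishing near the origin -/

theorem ckn_of_hardySobolev_interpolation {A X Q R : ℝ≥0∞} {C : NNReal} {r κ α β c : ℝ} (hr : 0 < r)
    (hκ : 0 ≤ κ) (hα : 0 ≤ α) (hβ : 0 ≤ β) (hc : 0 ≤ c)
    (h₁ : A ≤ C * (X * Q ^ c) ^ κ) (h₂ : R ≤ Q ^ α * A ^ β) :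
    R ^ (1 / r) ≤ (C ^ (β / r) : NNReal) * X ^ (κ * β / r) * Q ^ ((α + c * κ * β) / r) := by
  calc R ^ (1 / r) ≤ (Q ^ α * (C * (X * Q ^ c) ^ κ) ^ β) ^ (1 / r) := by
        gcongr
        exact h₂.trans (by gcongr)
    _ = _ := by
        rw [ENNReal.mul_rpow_of_nonneg _ _ hβ, ENNReal.mul_rpow_of_nonneg _ _ hκ,
          ENNReal.mul_rpow_of_nonneg _ _ hβ, ENNReal.mul_rpow_of_nonneg _ _ (by positivity),
          ENNReal.mul_rpow_of_nonneg _ _ (by positivity),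
          ENNReal.mul_rpow_of_nonneg _ _ (by positivity)]
        simp only [← ENNReal.rpow_mul]
        rw [ENNReal.coe_rpow_of_nonneg _ (by positivity), add_div,
          ENNReal.rpow_add_of_nonneg _ _ (by positivity) (by positivity)]
        simp only [mul_one_div]
        ring

theorem ckn_of_hardySobolev_absorption {Z X Q R : ℝ≥0∞} {C : NNReal} {κ α β c t : ℝ}
    (hκ : 0 < κ) (hc : 0 ≤ c) (ht : 0 ≤ t) (hR : R ≠ ⊤) (he : c * β * κ < 1)
    (h₁ : R ≤ C * (X * Z ^ c) ^ κ) (h₂ : Z ≤ Q ^ α * R ^ β) :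
    R ^ ((1 - c * β * κ) * t) ≤ (C ^ t : NNReal) * X ^ (κ * t) * Q ^ (α * c * κ * t) := by
  have h : R ≤ (C * X ^ κ * Q ^ (α * c * κ)) * R ^ (c * β * κ) := by
    calc R ≤ C * (X * (Q ^ α * R ^ β) ^ c) ^ κ := h₁.trans (by gcongr)
      _ = _ := by
        rw [ENNReal.mul_rpow_of_nonneg _ _ hc, ENNReal.mul_rpow_of_nonneg _ _ hκ.le,
          ENNReal.mul_rpow_of_nonneg _ _ hκ.le]
        simp only [← ENNReal.rpow_mul]
        rw [mul_comm β c]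
        ring
  have h3 := rpow_one_sub_le he hR h
  rw [ENNReal.rpow_mul]
  refine (ENNReal.rpow_le_rpow h3 ht).trans (le_of_eq ?_)
  rw [ENNReal.mul_rpow_of_nonneg _ _ ht, ENNReal.mul_rpow_of_nonneg _ _ ht,
    ENNReal.coe_rpow_of_nonneg _ ht]
  simp only [← ENNReal.rpow_mul]

/-- The Caffarelli-Kohn-Nirenberg inequality for functions vanishing near the origin. -/
theorem ckn_away_from_zero {N : ℕ} (hN : 2 ≤ N) {p q r μ σ s a k : ℝ} (hp : 1 < p) (hq : 0 < q)
    (hr : 0 < r) (ha : 0 < a) (ha1 : a < 1) (hk0 : 0 ≤ k) (hk1 : k ≤ 1) (hσ : σ < N) (hs : s < N)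
    (hμ : μ + p < N) (hx : 1 / r = (1 - a) / q + a * (1 / p - k / N))
    (hy : s / r = (1 - a) * (σ / q) + a * (μ / p + 1 - k)) :
    ∃ C : NNReal, ∀ w : Space N → ℝ, ContDiff ℝ 1 w → HasCompactSupport w → 0 ∉ tsupport w →
      wInt volume r s w ^ (1 / r) ≤
        C * (wInt volume p μ (fderiv ℝ w) ^ (1 / p)) ^ a * (wInt volume q σ w ^ (1 / q)) ^ (1 - a) := by
  have hp0 : 0 < p := by linarith
  have hN2 : (2 : ℝ) ≤ N := by exact_mod_cast hN
  have hN0 : (0 : ℝ) < N := by linarith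
  have hNk : (0 : ℝ) < N - k := by linarith
  have hc : 0 < 1 - 1 / p := by rw [sub_pos, div_lt_one hp0]; exact hp
  obtain ⟨c, hcdef⟩ : ∃ c, c = 1 - 1 / p := ⟨_, rfl⟩
  obtain ⟨κ, hκ⟩ : ∃ κ : ℝ, κ = N / (N - k) := ⟨_, rfl⟩
  have hκ0 : 0 < κ := by rw [hκ]; positivity
  have hκk : 1 / κ = 1 - k / N := by rw [hκ]; field_simp
  have ha1' : 0 < 1 - a := by linarith
  rw [← hcdef] at hc
  have hp' : 1 / p = 1 - c := by linarith
  -- The sign of `(1-a)/q - a*c` decides the choice of `γ`. If it is nonnegative, `γ = 1 + q*c`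
  -- makes the Hölder factor the `L^q` integral, and the `L^r` integral is interpolated between this
  -- and the one with exponent `κ*γ`. Otherwise `γ = r/κ` puts the `L^r` integral on the left; the
  -- Hölder factor is interpolated between `L^q` and `L^r`, and the power of the latter is absorbed.
  rcases le_or_gt (a * c) ((1 - a) / q) with hcase | hcase
  · have hb : μ / p + σ * c + 1 < N := by
      have h1 : (σ - N) * c < 0 := mul_neg_of_neg_of_pos (by linarith) hc
      have h2 : (μ + p) / p < N / p := by gcongr
      have h3 : (μ + p) / p = μ / p + 1 := by field_simp
      have h4 : N / p = N * (1 - c) := by rw [← hp']; ring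
      linarith
    obtain ⟨C, hC⟩ := hardySobolev_rpow hN (μ := μ) (γ := 1 + q * c) (m := q) (τ := σ) hp
      (by nlinarith [mul_pos hq hc]) hb hk0 hk1 hκ (by rw [← hcdef]; ring) (by rw [← hcdef]; ring)
    rw [← hcdef] at hC
    refine ⟨C ^ (a * r / κ / r), fun w hw hcs h0 => ?_⟩
    have hγ : 0 < κ * (1 + q * c) := by positivity
    have hα : 0 ≤ ((1 - a) / q - a * c) * r := mul_nonneg (by linarith) hr.le
    have hi := wInt_interpolation hN hw.continuous (r := r) (r₀ := q) (r₁ := κ * (1 + q * c))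
      (s := s) (s₀ := σ) (s₁ := κ * (μ / p + σ * c + 1 - k)) (α := ((1 - a) / q - a * c) * r)
      (β := a * r / κ) hq hγ hα (by positivity)
      (by
        have : a * r / κ = a * r * (1 / κ) := by ring
        rw [this, hκk]
        have h5 : r * (1 / r) = 1 := by field_simp
        rw [hx, hp'] at h5
        linear_combination h5)
      (by field_simp; ring)
      (by
        have h5 : r * (s / r) = s := by field_simp
        rw [hy] at h5
        rw [← h5]
        field_simp; ring)
    have := ckn_of_hardySobolev_interpolation hr hκ0.le hα (by positivity) hc.le (hC w hw hcs h0) hi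
    rw [← ENNReal.rpow_mul (wInt volume q σ w)]
    convert this using 3
    · field_simp
    · field_simp; ring
  -- Written this way, the balance of exponents shows `γ = r/κ > 1` in the second case.
  · have hrκ : r / κ = 1 + r * (a * c - (1 - a) / q) + (1 - a) * r / κ := by
      have h1 : r * (1 / κ) - (1 - a) * r * (1 / κ) - r * a * (1 / κ) = 0 := by ring
      have h5 : r * (1 / r) = 1 := by field_simp
      rw [hx, hp'] at h5
      have e1 : r / κ = r * (1 / κ) := by ring
      have e2 : (1 - a) * r / κ = (1 - a) * r * (1 / κ) := by ring
      rw [e1, e2, hκk]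
      linear_combination h5
    have hγ : 1 < r / κ := by
      rw [hrκ]
      have := mul_pos hr (sub_pos.2 hcase)
      have : 0 < (1 - a) * r / κ := by positivity
      linarith
    have hb : s / κ - 1 + k + 1 < N := by
      have h1 : s / κ < N / κ := by gcongr
      have h2 : N / κ = N - k := by rw [hκ]; field_simp
      linarith
    obtain ⟨C, hC⟩ := hardySobolev_rpow hN (μ := μ) (γ := r / κ) (m := (r / κ - 1) / c)
      (τ := (s / κ - 1 + k - μ / p) / c) hp hγ hb hk0 hk1 hκ (by rw [← hcdef]; field_simp)
      (by rw [← hcdef]; field_simp)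
    rw [← hcdef] at hC
    refine ⟨C ^ (a / κ), fun w hw hcs h0 => ?_⟩
    have hα : 0 ≤ (1 - a) / q / (a * c) := by positivity
    have hβ : 0 ≤ 1 - (1 - a) / q / (a * c) := by
      rw [sub_nonneg, div_le_one (by positivity)]; exact hcase.le
    have hβ' : 1 - (1 - a) / q / (a * c) = (1 / κ - 1 / (r * a)) / c := by
      rw [hκk]
      have h6 : 1 / (r * a) = 1 / r / a := by field_simp
      rw [h6, hx, hp']
      field_simp
      ring
    have h1 := hC w hw hcs h0
    rw [show κ * (r / κ) = r by field_simp, show κ * (s / κ - 1 + k + 1 - k) = s by field_simp; ring]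
      at h1
    have hi := wInt_interpolation hN hw.continuous (r := (r / κ - 1) / c) (r₀ := q) (r₁ := r)
      (s := (s / κ - 1 + k - μ / p) / c) (s₀ := σ) (s₁ := s) (α := (1 - a) / q / (a * c))
      (β := 1 - (1 - a) / q / (a * c)) hq hr hα hβ (by ring) (by rw [hβ']; field_simp; ring)
      (by
        rw [hβ']
        have h7 : (1 - a) * (σ / q) = s / r - a * (μ / p + 1 - k) := by linarith
        have h8 : (1 - a) / q / (a * c) * σ = (1 - a) * (σ / q) / (a * c) := by ring
        rw [h8, h7]
        field_simp; ring)
    -- After absorption `R` keeps the power `κ/(r*a)`; raising to `t = a/κ` turns it into `1/r`.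
    have he : c * (1 - (1 - a) / q / (a * c)) * κ = 1 - κ / (r * a) := by
      rw [hβ']; field_simp
    have := ckn_of_hardySobolev_absorption hκ0 hc.le (t := a / κ) (by positivity)
      (wInt_lt_top hN hr hs hw.continuous hcs).ne
      (by rw [he]; have : 0 < κ / (r * a) := by positivity
          linarith) h1 hi
    rw [← ENNReal.rpow_mul (wInt volume q σ w)]
    rw [he] at this
    convert this using 3
    · field_simp; ring
    · field_simp
    · field_simp

/-! ### Cutoffs and truncations -/

theorem norm_mul_norm_fderiv_comp_smul_le {N : ℕ} {g : Space N → ℝ} (hg : ContDiff ℝ 1 g) {M : ℝ}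
    (hM : ∀ y, ‖y‖ * ‖fderiv ℝ g y‖ ≤ M) {t : ℝ} (ht : 0 ≤ t) (x : Space N) :
    ‖x‖ * ‖fderiv ℝ (fun x => g (t • x)) x‖ ≤ M := by
  have h1 : HasFDerivAt (fun x : Space N => t • x) (t • ContinuousLinearMap.id ℝ (Space N)) x :=
    (hasFDerivAt_id x).const_smul t
  have h2 := (hg.differentiable one_ne_zero (t • x)).hasFDerivAt.comp x h1
  have h3 : fderiv ℝ (fun x => g (t • x)) x = _ := h2.fderiv
  rw [h3]
  have h4 := hM (t • x)
  rw [norm_smul, Real.norm_of_nonneg ht] at h4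
  rw [ContinuousLinearMap.comp_smul, ContinuousLinearMap.comp_id, norm_smul,
    Real.norm_of_nonneg ht]
  linarith

/-- With `g` a bump equal to `1` on the unit ball and `0` outside radius `2`, take `(1 - g((j+1)x))
g(x/(j+1))`. The quantity `|x| |∇g|` is invariant under dilation, so its bound does not depend on
`j`. -/
theorem exists_cutoff {N : ℕ} :
    ∃ (η : ℕ → Space N → ℝ) (M : ℝ), 0 ≤ M ∧ ∀ j, ContDiff ℝ 1 (η j) ∧ HasCompactSupport (η j) ∧
      0 ∉ tsupport (η j) ∧ (∀ x, 0 ≤ η j x ∧ η j x ≤ 1) ∧ (∀ x, ‖x‖ * ‖fderiv ℝ (η j) x‖ ≤ M) ∧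
      ∀ x ≠ 0, Tendsto (fun j => η j x) atTop (𝓝 1) := by
  let g : ContDiffBump (0 : Space N) := ⟨1, 2, one_pos, one_lt_two⟩
  have hg : ContDiff ℝ 1 g := g.contDiff
  have hDg : Continuous fun y : Space N => ‖y‖ * ‖fderiv ℝ g y‖ :=
    continuous_norm.mul (hg.continuous_fderiv one_ne_zero).norm
  obtain ⟨M, hM⟩ : ∃ M, ∀ y, ‖y‖ * ‖fderiv ℝ g y‖ ≤ M := by
    obtain ⟨M, hM⟩ := hDg.bounded_above_of_compact_support
      ((g.hasCompactSupport.fderiv ℝ).norm.mul_left)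
    exact ⟨M, fun y => (le_abs_self _).trans (hM y)⟩
  have hM0 : 0 ≤ M := le_trans (by positivity) (hM 0)
  refine ⟨fun j x => (1 - g (((j : ℝ) + 1) • x)) * g (((j : ℝ) + 1)⁻¹ • x), M + M, by positivity,
    fun j => ?_⟩
  have hj : (0 : ℝ) < (j : ℝ) + 1 := by positivity
  have hA : ContDiff ℝ 1 fun x : Space N => g (((j : ℝ) + 1) • x) := hg.comp (by fun_prop)
  have hB : ContDiff ℝ 1 fun x : Space N => g (((j : ℝ) + 1)⁻¹ • x) := hg.comp (by fun_prop)
  refine ⟨(contDiff_const.sub hA).mul hB, ?_, ?_, fun x => ⟨?_, ?_⟩, fun x => ?_, fun x hx => ?_⟩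
  · exact (g.hasCompactSupport.comp_smul (inv_ne_zero hj.ne')).mul_left
  · rw [notMem_tsupport_iff_eventuallyEq]
    have ht : Tendsto (fun x : Space N => ((j : ℝ) + 1) • x) (𝓝 0) (𝓝 0) := by
      have : Continuous (fun x : Space N => ((j : ℝ) + 1) • x) := by fun_prop
      simpa using this.tendsto 0
    filter_upwards [ht.eventually g.eventuallyEq_one] with x hx
    simp [hx]
  · exact mul_nonneg (sub_nonneg.2 g.le_one) g.nonneg
  · exact mul_le_one₀ (sub_le_self _ g.nonneg) g.nonneg g.le_one
  · have h1 := ((hA.differentiable one_ne_zero x).hasFDerivAt.const_sub 1).fun_mul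
      (hB.differentiable one_ne_zero x).hasFDerivAt
    rw [h1.fderiv]
    calc _ ≤ ‖x‖ * (‖(1 - g (((j : ℝ) + 1) • x))‖ *
          ‖fderiv ℝ (fun x : Space N => g (((j : ℝ) + 1)⁻¹ • x)) x‖ +
          ‖g (((j : ℝ) + 1)⁻¹ • x)‖ * ‖fderiv ℝ (fun x : Space N => g (((j : ℝ) + 1) • x)) x‖) := by
          gcongr
          refine (norm_add_le _ _).trans (le_of_eq ?_)
          rw [norm_smul, norm_smul, norm_neg]
      _ ≤ ‖x‖ * (1 * ‖fderiv ℝ (fun x : Space N => g (((j : ℝ) + 1)⁻¹ • x)) x‖ +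
          1 * ‖fderiv ℝ (fun x : Space N => g (((j : ℝ) + 1) • x)) x‖) := by
          gcongr
          · rw [Real.norm_of_nonneg (sub_nonneg.2 g.le_one)]
            exact sub_le_self _ g.nonneg
          · rw [Real.norm_of_nonneg g.nonneg]; exact g.le_one
      _ ≤ M + M := by
          rw [one_mul, one_mul, mul_add]
          exact add_le_add (norm_mul_norm_fderiv_comp_smul_le hg hM (inv_nonneg.2 hj.le) x)
            (norm_mul_norm_fderiv_comp_smul_le hg hM hj.le x)
  · have hx' : 0 < ‖x‖ := norm_pos_iff.2 hx
    refine tendsto_const_nhds.congr' ?_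
    filter_upwards [eventually_ge_atTop ⌈2 / ‖x‖⌉₊, eventually_ge_atTop ⌈‖x‖⌉₊] with i hi hi'
    have h1 : 2 / ‖x‖ ≤ i := Nat.ceil_le.1 hi
    have h2 : ‖x‖ ≤ i := Nat.ceil_le.1 hi'
    have hi0 : (0 : ℝ) < (i : ℝ) + 1 := by positivity
    have e1 : g (((i : ℝ) + 1) • x) = 0 := by
      apply g.zero_of_le_dist
      change (2 : ℝ) ≤ _
      rw [dist_zero_right, norm_smul, Real.norm_of_nonneg hi0.le]
      rw [div_le_iff₀ hx'] at h1
      nlinarith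
    have e2 : g (((i : ℝ) + 1)⁻¹ • x) = 1 := by
      apply g.one_of_mem_closedBall
      rw [mem_closedBall_zero_iff, norm_smul, norm_inv, Real.norm_of_nonneg hi0.le]
      change _ ≤ (1 : ℝ)
      rw [inv_mul_le_iff₀ hi0]
      linarith
    rw [e1, e2]; norm_num

/-- A smooth bounded truncation of the identity. -/
noncomputable def trunc (m t : ℝ) : ℝ := m * Real.arctan (t / m)

theorem hasDerivAt_trunc {m : ℝ} (hm : 0 < m) (t : ℝ) :
    HasDerivAt (trunc m) (1 / (1 + (t / m) ^ 2)) t := by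
  have h := (((hasDerivAt_id t).div_const m).arctan).const_mul m
  refine h.congr_deriv ?_
  simp only [id]
  field_simp

theorem contDiff_trunc (m : ℝ) : ContDiff ℝ 1 (trunc m) :=
  contDiff_const.mul (contDiff_id.div_const m).arctan

theorem trunc_zero (m : ℝ) : trunc m 0 = 0 := by simp [trunc]

theorem norm_deriv_trunc_le (t m : ℝ) : ‖1 / (1 + (t / m) ^ 2)‖ ≤ 1 := by
  rw [Real.norm_of_nonneg (by positivity), div_le_one (by positivity)]
  nlinarith [sq_nonneg (t / m)]

theorem norm_trunc_le {m : ℝ} (hm : 0 < m) (t : ℝ) : ‖trunc m t‖ ≤ ‖t‖ := by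
  have := (convex_univ (𝕜 := ℝ) (E := ℝ)).norm_image_sub_le_of_norm_hasDerivWithin_le (C := 1)
    (fun x _ => (hasDerivAt_trunc hm x).hasDerivWithinAt) (fun x _ => norm_deriv_trunc_le x m)
    (Set.mem_univ 0) (Set.mem_univ t)
  simpa [trunc_zero] using this

theorem norm_trunc_le_const {m : ℝ} (hm : 0 < m) (t : ℝ) : ‖trunc m t‖ ≤ m * (Real.pi / 2) := by
  rw [trunc, norm_mul, Real.norm_of_nonneg hm.le, Real.norm_eq_abs]
  gcongr
  rw [abs_le]
  exact ⟨(Real.neg_pi_div_two_lt_arctan _).le, (Real.arctan_lt_pi_div_two _).le⟩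

/-- `trunc (j+1) t` is the difference quotient at `0` of `x ↦ arctan (t * x)` with step `1/(j+1)`.
-/
theorem tendsto_trunc (t : ℝ) : Tendsto (fun j : ℕ => trunc ((j : ℝ) + 1) t) atTop (𝓝 t) := by
  have h1 : HasDerivAt (fun x => Real.arctan (t * x)) t 0 := by
    have := ((hasDerivAt_id (0 : ℝ)).const_mul t).arctan
    simpa using this
  have h2 := h1.tendsto_slope_zero_right
  have h3 : Tendsto (fun j : ℕ => ((j : ℝ) + 1)⁻¹) atTop (𝓝[>] 0) := by
    refine tendsto_nhdsWithin_iff.2 ⟨?_, Eventually.of_forall fun j => ?_⟩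
    · simpa using tendsto_one_div_add_atTop_nhds_zero_nat (𝕜 := ℝ)
    · simp only [Set.mem_Ioi]; positivity
  refine (h2.comp h3).congr fun j => ?_
  simp [trunc, div_eq_mul_inv]

theorem norm_fderiv_mul_trunc_le {N : ℕ} {η φ : Space N → ℝ} (hη : ContDiff ℝ 1 η)
    (hφ : ContDiff ℝ 1 φ) {m : ℝ} (hm : 0 < m) {x : Space N} (h0 : 0 ≤ η x) (h1 : η x ≤ 1) :
    ‖fderiv ℝ (fun x => η x * trunc m (φ x)) x‖ ≤ ‖fderiv ℝ φ x‖ + ‖fderiv ℝ η x‖ * ‖φ x‖ := by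
  have hd := (hη.differentiable one_ne_zero x).hasFDerivAt.fun_mul
    ((hasDerivAt_trunc hm (φ x)).comp_hasFDerivAt x (hφ.differentiable one_ne_zero x).hasFDerivAt)
  have hd' : fderiv ℝ (fun x => η x * trunc m (φ x)) x = _ := hd.fderiv
  rw [hd']
  refine (norm_add_le _ _).trans (add_le_add ?_ ?_)
  · rw [norm_smul, norm_smul, Real.norm_of_nonneg h0]
    calc _ ≤ 1 * (1 * ‖fderiv ℝ φ x‖) := by
          gcongr
          exact norm_deriv_trunc_le _ _
      _ = _ := by ring
  · rw [norm_smul, mul_comm]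
    gcongr
    exact norm_trunc_le hm _

/-! ### Passage to the limit -/

theorem wInt_rpow_le_add {N : ℕ} {E F G : Type*} [NormedAddCommGroup E] [NormedAddCommGroup F]
    [NormedAddCommGroup G] {ν : Measure (Space N)} {p μ : ℝ} (hp : 1 ≤ p) {f : Space N → E}
    {g : Space N → F} {h : Space N → G} (hg : AEStronglyMeasurable g ν)
    (hh : AEStronglyMeasurable h ν) (hle : ∀ᵐ x ∂ν, ‖f x‖ ≤ ‖g x‖ + ‖h x‖) :
    wInt ν p μ f ^ (1 / p) ≤ wInt ν p μ g ^ (1 / p) + wInt ν p μ h ^ (1 / p) := by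
  have hp0 : 0 < p := by linarith
  have key : ∀ (a : ℝ) (x : Space N), 0 ≤ a →
      ENNReal.ofReal (a / ‖x‖ ^ (μ / p)) ^ p = ENNReal.ofReal (a ^ p / ‖x‖ ^ μ) := by
    intro a x ha
    rw [ENNReal.ofReal_rpow_of_nonneg (by positivity) hp0.le, Real.div_rpow ha (by positivity),
      ← Real.rpow_mul (norm_nonneg _), div_mul_cancel₀ _ hp0.ne']
  have hM := ENNReal.lintegral_Lp_add_le (μ := ν) (p := p)
    (f := fun x => ENNReal.ofReal (‖g x‖ / ‖x‖ ^ (μ / p)))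
    (g := fun x => ENNReal.ofReal (‖h x‖ / ‖x‖ ^ (μ / p)))
    ((hg.norm.aemeasurable.div (measurable_norm.pow_const _).aemeasurable).ennreal_ofReal)
    ((hh.norm.aemeasurable.div (measurable_norm.pow_const _).aemeasurable).ennreal_ofReal) hp
  simp only [Pi.add_apply, key _ _ (norm_nonneg _)] at hM
  refine le_trans (ENNReal.rpow_le_rpow ?_ (by positivity)) hM
  refine lintegral_mono_ae ?_
  filter_upwards [hle] with x hx
  rw [← ENNReal.ofReal_add (by positivity) (by positivity), ← add_div, key _ _ (by positivity)]
  refine ENNReal.ofReal_le_ofReal ?_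
  gcongr

theorem wInt_restrict_eq {N : ℕ} {F : Type*} [NormedAddCommGroup F] {Ω : Set (Space N)}
    (hΩ : MeasurableSet Ω) {r s : ℝ} (hr : 0 < r) {f : Space N → F} (hf : ∀ x ∉ Ω, f x = 0) :
    wInt (volume.restrict Ω) r s f = wInt volume r s f := by
  rw [wInt, ← lintegral_indicator hΩ]
  refine lintegral_congr fun x => ?_
  by_cases hx : x ∈ Ω
  · rw [Set.indicator_of_mem hx]
  · rw [Set.indicator_of_notMem hx, hf x hx]
    simp [Real.zero_rpow hr.ne']

theorem norm_gradient_eq {N : ℕ} (φ : Space N → ℝ) (x : Space N) :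
    ‖gradient φ x‖ = ‖fderiv ℝ φ x‖ :=
  LinearIsometryEquiv.norm_map _ _

theorem aemeasurable_weight {N : ℕ} {F : Type*} [NormedAddCommGroup F] {ν : Measure (Space N)}
    (r s : ℝ) {f : Space N → F} (hf : AEStronglyMeasurable f ν) :
    AEMeasurable (fun x => ENNReal.ofReal (‖f x‖ ^ r / ‖x‖ ^ s)) ν :=
  ((hf.norm.aemeasurable.pow_const _).div
    (measurable_norm.pow_const _).aemeasurable).ennreal_ofReal

theorem tendsto_weight {F : Type*} [NormedAddCommGroup F] {r : ℝ} (hr : 0 < r) (d : ℝ)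
    {f : ℕ → F} {y : F} (h : Tendsto f atTop (𝓝 y)) :
    Tendsto (fun n => ENNReal.ofReal (‖f n‖ ^ r / d)) atTop (𝓝 (ENNReal.ofReal (‖y‖ ^ r / d))) :=
  ENNReal.tendsto_ofReal ((h.norm.rpow_const (Or.inr hr.le)).div_const _)

theorem wInt_le_of_tendsto {N : ℕ} {F : Type*} [NormedAddCommGroup F] {ν : Measure (Space N)}
    {r s : ℝ} (hr : 0 < r) {w : ℕ → Space N → F} {v : Space N → F} {B : ℕ → ℝ≥0∞} {b : ℝ≥0∞}
    (hm : ∀ n, AEStronglyMeasurable (w n) ν)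
    (hlim : ∀ᵐ x ∂ν, Tendsto (fun n => w n x) atTop (𝓝 (v x)))
    (hle : ∀ n, wInt ν r s (w n) ≤ B n) (hB : Tendsto B atTop (𝓝 b)) : wInt ν r s v ≤ b := by
  calc wInt ν r s v
      = ∫⁻ x, liminf (fun n => ENNReal.ofReal (‖w n x‖ ^ r / ‖x‖ ^ s)) atTop ∂ν := by
        refine lintegral_congr_ae ?_
        filter_upwards [hlim] with x hx
        exact (tendsto_weight hr _ hx).liminf_eq.symm
    _ ≤ liminf (fun n => wInt ν r s (w n)) atTop :=
        lintegral_liminf_le' fun n => aemeasurable_weight r s (hm n)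
    _ ≤ liminf B atTop := liminf_le_liminf (Eventually.of_forall hle)
    _ = b := hB.liminf_eq

/-- Truncation does not increase the gradient, and the cutoff adds at most `M |φ| / |x|`, which the
Hardy inequality controls. Hence `C` depends on the cutoff only through `M`, and not on `m`. -/
theorem wInt_fderiv_mul_trunc_le {N : ℕ} (hN : 2 ≤ N) {p μ M : ℝ} (hp : 1 < p) (hμ : μ + p < N)
    (hM : 0 ≤ M) :
    ∃ C : NNReal, ∀ (φ η : Space N → ℝ) (m : ℝ), 0 < m → ContDiff ℝ 1 φ → HasCompactSupport φ →
      ContDiff ℝ 1 η → (∀ x, 0 ≤ η x ∧ η x ≤ 1) → (∀ x, ‖x‖ * ‖fderiv ℝ η x‖ ≤ M) →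
      wInt volume p μ (fderiv ℝ (fun x => η x * trunc m (φ x))) ^ (1 / p) ≤
        C * wInt volume p μ (fderiv ℝ φ) ^ (1 / p) := by
  have hp0 : 0 < p := by linarith
  obtain ⟨C, hC⟩ := hardy hN hp hμ
  refine ⟨1 + M.toNNReal * C, fun φ η m hm hφ hc hη h01 hMx => ?_⟩
  have hle : ∀ᵐ x : Space N, ‖fderiv ℝ (fun x => η x * trunc m (φ x)) x‖ ≤
      ‖fderiv ℝ φ x‖ + ‖M / ‖x‖ * φ x‖ := by
    filter_upwards [ae_ne_zero hN] with x hx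
    have hx' : 0 < ‖x‖ := norm_pos_iff.2 hx
    refine (norm_fderiv_mul_trunc_le hη hφ hm (h01 x).1 (h01 x).2).trans ?_
    rw [norm_mul, Real.norm_of_nonneg (by positivity : 0 ≤ M / ‖x‖)]
    gcongr
    rw [le_div_iff₀ hx', mul_comm]
    exact hMx x
  have h1 := wInt_rpow_le_add (μ := μ) hp.le
    (hφ.continuous_fderiv one_ne_zero).aestronglyMeasurable
    (((measurable_const.div measurable_norm).mul hφ.continuous.measurable).aestronglyMeasurable)
    hle
  have h2 : wInt volume p μ (fun x => M / ‖x‖ * φ x) =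
      ENNReal.ofReal M ^ p * wInt volume p (μ + p) φ := by
    rw [wInt, wInt, ENNReal.ofReal_rpow_of_nonneg hM hp0.le,
      ← lintegral_const_mul' _ _ ENNReal.ofReal_ne_top]
    refine lintegral_congr_ae ?_
    filter_upwards [ae_ne_zero hN] with x hx
    have hx' : 0 < ‖x‖ := norm_pos_iff.2 hx
    rw [← ENNReal.ofReal_mul (by positivity), norm_mul,
      Real.norm_of_nonneg (by positivity : 0 ≤ M / ‖x‖), Real.mul_rpow (by positivity)
      (by positivity), Real.div_rpow hM hx'.le, Real.rpow_add hx']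
    congr 1
    field_simp
  refine h1.trans ?_
  change _ + wInt volume p μ (fun x => M / ‖x‖ * φ x) ^ (1 / p) ≤ _
  rw [h2, ENNReal.mul_rpow_of_nonneg _ _ (by positivity), ← ENNReal.rpow_mul,
    mul_one_div_cancel hp0.ne', ENNReal.rpow_one]
  calc _ ≤ wInt volume p μ (fderiv ℝ φ) ^ (1 / p) +
        ENNReal.ofReal M * (C * wInt volume p μ (fderiv ℝ φ) ^ (1 / p)) := by
        gcongr
        exact hC φ hφ hc
    _ = _ := by rw [ENNReal.ofReal]; push_cast; ring

/-- Dominated by `(m π/2)^q |x|^(-σ)` on the compact support of `η`, integrable since `σ < N`; no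
bound on `φ n` is needed. -/
theorem tendsto_wInt_mul_trunc {N : ℕ} (hN : 2 ≤ N) {q σ m : ℝ} (hq : 0 < q) (hσ : σ < N)
    (hm : 0 < m) {ν : Measure (Space N)} (hν : ν ≤ volume) {η : Space N → ℝ}
    (hη : Continuous η) (hc : HasCompactSupport η) (h01 : ∀ x, 0 ≤ η x ∧ η x ≤ 1)
    {φ : ℕ → Space N → ℝ} {u : Space N → ℝ} (hφ : ∀ n, Continuous (φ n))
    (hlim : ∀ᵐ x ∂ν, Tendsto (fun n => φ n x) atTop (𝓝 (u x))) :
    Tendsto (fun n => wInt ν q σ (fun x => η x * trunc m (φ n x))) atTop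
      (𝓝 (wInt ν q σ (fun x => η x * trunc m (u x)))) := by
  refine tendsto_lintegral_of_dominated_convergence'
    ((tsupport η).indicator fun x =>
      ENNReal.ofReal ((m * (Real.pi / 2)) ^ q) * ENNReal.ofReal (1 / ‖x‖ ^ σ)) (fun n => ?_)
    (fun n => ae_of_all _ fun x => ?_) ?_ ?_
  · exact aemeasurable_weight q σ
      (hη.mul ((contDiff_trunc m).continuous.comp (hφ n))).aestronglyMeasurable
  · by_cases hx : x ∈ tsupport η
    · rw [Set.indicator_of_mem hx, ← ENNReal.ofReal_mul (by positivity), mul_one_div]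
      refine ENNReal.ofReal_le_ofReal ?_
      gcongr
      rw [norm_mul, Real.norm_of_nonneg (h01 x).1]
      exact (mul_le_of_le_one_left (norm_nonneg _) (h01 x).2).trans (norm_trunc_le_const hm _)
    · change ENNReal.ofReal (‖η x * trunc m (φ n x)‖ ^ q / ‖x‖ ^ σ) ≤ _
      rw [image_eq_zero_of_notMem_tsupport hx]
      simp [Real.zero_rpow hq.ne']
  · refine ((lintegral_mono' hν le_rfl).trans_lt ?_).ne
    rw [lintegral_indicator (isClosed_tsupport η).measurableSet,
      lintegral_const_mul' _ _ ENNReal.ofReal_ne_top]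
    exact ENNReal.mul_lt_top ENNReal.ofReal_lt_top (lintegral_weight_lt_top hN hσ hc)
  · filter_upwards [hlim] with x hx
    exact tendsto_weight hq _
      (tendsto_const_nhds.mul (((contDiff_trunc m).continuous.tendsto _).comp hx))

/-- The Caffarelli-Kohn-Nirenberg inequality on `E`. -/
theorem ckn {N : ℕ} (hN : 2 ≤ N) {p q r μ σ s a k : ℝ} (hp : 1 < p) (hq : 0 < q)
    (hr : 0 < r) (ha : 0 < a) (ha1 : a < 1) (hk0 : 0 ≤ k) (hk1 : k ≤ 1) (hσ : σ < N) (hs : s < N)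
    (hμ : μ + p < N) (hx : 1 / r = (1 - a) / q + a * (1 / p - k / N))
    (hy : s / r = (1 - a) * (σ / q) + a * (μ / p + 1 - k)) :
    ∃ C : NNReal, ∀ Ω : Set (Space N), IsOpen Ω → ∀ (u : Space N → ℝ) (G : Space N → Space N),
      MemE Ω p q μ σ u G →
        weightedNorm Ω r s u ≤ C * weightedNorm Ω p μ G ^ a * weightedNorm Ω q σ u ^ (1 - a) := by
  have hp0 : 0 < p := by linarith
  have ha1' : 0 < 1 - a := by linarith
  obtain ⟨η, M, hM, hη⟩ := exists_cutoff (N := N)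
  obtain ⟨C₁, hC₁⟩ := ckn_away_from_zero hN hp hq hr ha ha1 hk0 hk1 hσ hs hμ hx hy
  obtain ⟨C₂, hC₂⟩ := wInt_fderiv_mul_trunc_le hN hp hμ hM
  refine ⟨C₁ * C₂ ^ a, fun Ω hΩ u G ⟨⟨⟨hGm, hGfin⟩, φ, hφ, hφG, hφu⟩, hum, hufin⟩ => ?_⟩
  rw [weightedNorm_eq, weightedNorm_eq] at *
  set ν := (volume : Measure (Space N)).restrict Ω with hν
  set X := wInt ν p μ G ^ (1 / p) with hX
  set Q := wInt ν q σ u ^ (1 / q) with hQ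
  have hφ1 : ∀ n, ContDiff ℝ 1 (φ n) := fun n => (hφ n).1.of_le (by norm_cast)
  have hj : ∀ j : ℕ, (0 : ℝ) < (j : ℝ) + 1 := fun j => by positivity
  have hw1 : ∀ j n, ContDiff ℝ 1 (fun x => η j x * trunc ((j : ℝ) + 1) (φ n x)) := fun j n =>
    (hη j).1.mul ((contDiff_trunc _).comp (hφ1 n))
  -- energy bound for the approximations
  have hgrad : ∀ n, wInt volume p μ (fderiv ℝ (φ n)) ^ (1 / p) ≤
      wInt ν p μ (fun x => gradient (φ n) x - G x) ^ (1 / p) + X := by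
    intro n
    have hcont : Continuous (gradient (φ n)) :=
      (LinearIsometryEquiv.continuous _).comp ((hφ1 n).continuous_fderiv one_ne_zero)
    rw [← wInt_restrict_eq hΩ.measurableSet hp0 fun x hx => ?_]
    · refine wInt_rpow_le_add hp.le (hcont.aestronglyMeasurable.sub hGm) hGm (ae_of_all _ fun x => ?_)
      rw [← norm_gradient_eq]
      calc ‖gradient (φ n) x‖ = ‖gradient (φ n) x - G x + G x‖ := by rw [sub_add_cancel]
        _ ≤ _ := norm_add_le _ _
    · exact image_eq_zero_of_notMem_tsupport fun h =>
        hx ((hφ n).2.2 (tsupport_fderiv_subset ℝ h))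
  have hQle : ∀ j : ℕ, wInt ν q σ (fun x => η j x * trunc ((j : ℝ) + 1) (u x)) ≤ wInt ν q σ u := by
    intro j
    refine lintegral_mono fun x => ENNReal.ofReal_le_ofReal ?_
    gcongr
    obtain ⟨-, -, -, h01, -⟩ := hη j
    rw [norm_mul, Real.norm_of_nonneg (h01 x).1]
    exact (mul_le_of_le_one_left (norm_nonneg _) (h01 x).2).trans (norm_trunc_le (hj j) _)
  have hstep : ∀ j : ℕ, wInt ν r s (fun x => η j x * trunc ((j : ℝ) + 1) (u x)) ≤
      (C₁ * (C₂ * X) ^ a * Q ^ (1 - a)) ^ r := by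
    intro j
    obtain ⟨hη1, hηc, hη0, h01, hηM, -⟩ := hη j
    have hT := tendsto_wInt_mul_trunc hN hq hσ (hj j) (Measure.restrict_le_self : ν ≤ volume)
      hη1.continuous hηc h01 (fun n => (hφ1 n).continuous) hφu
    have hQj := hQle j
    -- Fatou in `n` with `j` fixed; the right side converges because its gradient error tends to `0`
    -- and its `L^q` factor converges by `hT`.
    refine (wInt_le_of_tendsto hr (w := fun n x => η j x * trunc ((j : ℝ) + 1) (φ n x))
      (B := fun n => (C₁ * (C₂ * (wInt ν p μ (fun x => gradient (φ n) x - G x) ^ (1 / p) + X)) ^ a *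
        (wInt ν q σ (fun x => η j x * trunc ((j : ℝ) + 1) (φ n x)) ^ (1 / q)) ^ (1 - a)) ^ r)
      (b := (C₁ * (C₂ * (0 + X)) ^ a *
        (wInt ν q σ (fun x => η j x * trunc ((j : ℝ) + 1) (u x)) ^ (1 / q)) ^ (1 - a)) ^ r)
      (fun n => (hw1 j n).continuous.aestronglyMeasurable) ?_ (fun n => ?_) ?_).trans ?_
    · filter_upwards [hφu] with x hx
      exact tendsto_const_nhds.mul (((contDiff_trunc _).continuous.tendsto _).comp hx)
    · have h1 := hC₁ _ (hw1 j n) hηc.mul_right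
        (fun h => hη0 (tsupport_mul_subset_left (f := η j) h))
      have h2 := (hC₂ (φ n) (η j) _ (hj j) (hφ1 n) (hφ n).2.1 hη1 h01 hηM).trans
        (mul_le_mul_right (hgrad n) _)
      have h3 : wInt ν r s (fun x => η j x * trunc ((j : ℝ) + 1) (φ n x)) ≤
          wInt volume r s (fun x => η j x * trunc ((j : ℝ) + 1) (φ n x)) :=
        lintegral_mono' Measure.restrict_le_self le_rfl
      have h4 : wInt ν q σ (fun x => η j x * trunc ((j : ℝ) + 1) (φ n x)) =
          wInt volume q σ (fun x => η j x * trunc ((j : ℝ) + 1) (φ n x)) := by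
        refine wInt_restrict_eq hΩ.measurableSet hq fun x hx => ?_
        rw [image_eq_zero_of_notMem_tsupport fun h => hx ((hφ n).2.2 h), trunc_zero, mul_zero]
      rw [h4]
      refine h3.trans ?_
      rw [← ENNReal.rpow_inv_le_iff hr, ← one_div]
      refine h1.trans ?_
      gcongr
    · have hfin : wInt ν q σ (fun x => η j x * trunc ((j : ℝ) + 1) (u x)) ≠ ⊤ := by
        refine ne_top_of_le_ne_top ?_ hQj
        intro h
        rw [hQ, h, ENNReal.top_rpow_of_pos (by positivity)] at hufin
        exact lt_irrefl _ hufin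
      refine Filter.Tendsto.ennrpow_const _ ?_
      refine ENNReal.Tendsto.mul (ENNReal.Tendsto.const_mul ?_ (Or.inr ENNReal.coe_ne_top))
        (Or.inr ?_) ?_ (Or.inr ?_)
      · refine Filter.Tendsto.ennrpow_const _ (ENNReal.Tendsto.const_mul ?_
          (Or.inr ENNReal.coe_ne_top))
        exact hφG.add tendsto_const_nhds
      · exact ENNReal.rpow_ne_top_of_nonneg ha1'.le
          (ENNReal.rpow_ne_top_of_nonneg (by positivity) hfin)
      · exact Filter.Tendsto.ennrpow_const _ (Filter.Tendsto.ennrpow_const _ hT)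
      · refine ENNReal.mul_ne_top ENNReal.coe_ne_top (ENNReal.rpow_ne_top_of_nonneg ha.le ?_)
        rw [zero_add]
        exact ENNReal.mul_ne_top ENNReal.coe_ne_top hGfin.ne
    · rw [zero_add, hQ]
      gcongr
  have hfinal : wInt ν r s u ≤ (C₁ * (C₂ * X) ^ a * Q ^ (1 - a)) ^ r := by
    refine wInt_le_of_tendsto hr (w := fun (j : ℕ) x => η j x * trunc ((j : ℝ) + 1) (u x))
      (fun j => ?_) ?_ hstep tendsto_const_nhds
    · exact (hη j).1.continuous.aestronglyMeasurable.mul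
        ((contDiff_trunc _).continuous.comp_aestronglyMeasurable hum)
    · filter_upwards [ae_restrict_of_ae (ae_ne_zero hN)] with x hx
      -- The convergence clause of `hη` is the same statement for every index, so its instance at
      -- `0` is used.
      simpa using (((fun j => (hη j).2.2.2.2.2 x hx) : ℕ → _) 0).mul (tendsto_trunc (u x))
  rw [one_div, ENNReal.rpow_inv_le_iff hr]
  refine hfinal.trans (le_of_eq ?_)
  rw [weightedNorm_eq Ω q σ, ← hν, ← hQ, ENNReal.mul_rpow_of_nonneg _ _ ha.le, ENNReal.coe_mul,
    ENNReal.coe_rpow_of_nonneg _ ha.le, mul_assoc (C₁ : ℝ≥0∞) (_ ^ a) (X ^ a)]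

end CKN

/-! ### The exponents of the theorem -/

theorem lemma3p1 (N : ℕ) (hN : 2 ≤ N) (p q r μ σ s : ℝ)
    (hp : 1 < p) (hσs : max σ s < μ + p) (hμ : μ + p < N)
    (hq1 : 1 ≤ q) (hq2 : (q : EReal) < min (CKN.pStar N p) (CKN.pStarW N p σ μ : EReal))
    (hr1 : max (p * (σ - s) / (N - μ - p) + q) ((σ - s) / (N - σ) * q + q) < r)
    (hr2 : (r : EReal) < min (CKN.pStar N p) (CKN.pStarW N p s μ : EReal))
    (h1 : p * (s - σ) + q * (μ + p - s) ≤ r * (μ + p - σ))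
    (h2 : (N * μ - N * s + p * s) * (r - q) ≤ (N * p - N * r + p * r) * (s - σ)) :
    CKN.cknA N p q r μ σ s ∈ Set.Ioo (0 : ℝ) 1 ∧
    (∃ C : ℝ, 0 < C ∧ ∀ Ω : Set (CKN.Space N), IsOpen Ω →
      ∀ (u : CKN.Space N → ℝ) (G : CKN.Space N → CKN.Space N), CKN.MemE Ω p q μ σ u G →
        CKN.weightedNorm Ω r s u ≤
          ENNReal.ofReal C * CKN.weightedNorm Ω p μ G ^ (CKN.cknA N p q r μ σ s) *
            CKN.weightedNorm Ω q σ u ^ (1 - CKN.cknA N p q r μ σ s)) ∧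
    (1 ≤ r → ∀ Ω : Set (CKN.Space N), IsOpen Ω → ∀ lam : ℝ, 0 < lam →
      ∃ K : ℝ, 0 < K ∧
        ∀ (u : CKN.Space N → ℝ) (G : CKN.Space N → CKN.Space N), CKN.MemE Ω p q μ σ u G →
          CKN.MemWeightedL Ω r s u ∧
          CKN.weightedNorm Ω r s u ≤ ENNReal.ofReal K * CKN.normE Ω p q μ σ lam u G) := by
  have hp0 : 0 < p := by linarith
  have hq0 : 0 < q := by linarith
  have hN0 : (0 : ℝ) < N := by exact_mod_cast (by omega : 0 < N)
  have hσ : σ < μ + p := (le_max_left _ _).trans_lt hσs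
  have hs : s < μ + p := (le_max_right _ _).trans_lt hσs
  have hNσ : 0 < N - σ := by linarith
  have hNs : 0 < N - s := by linarith
  have hNμ : 0 < N - p - μ := by linarith
  have hqσ : q * (N - p - μ) < p * (N - σ) := by
    have h := hq2.trans_le (min_le_right _ _)
    rw [EReal.coe_lt_coe_iff, CKN.pStarW, lt_div_iff₀ hNμ] at h
    exact h
  have hrs : r * (N - p - μ) < p * (N - s) := by
    have h := hr2.trans_le (min_le_right _ _)
    rw [EReal.coe_lt_coe_iff, CKN.pStarW, lt_div_iff₀ hNμ] at h
    exact h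
  have hqr : (N - s) * q < (N - σ) * r := by
    have h := (le_max_right _ _).trans_lt hr1
    have h3 : (σ - s) / (N - σ) * q + q = (N - s) * q / (N - σ) := by field_simp; ring
    rw [h3, div_lt_iff₀ hNσ] at h
    linarith
  have hr0 : 0 < r := by
    have : 0 < (N - σ) * r := (mul_pos hNs hq0).trans hqr
    exact pos_of_mul_pos_right this hNσ.le
  have hD : 0 < (N - σ) * p - (N - μ - p) * q := by linarith
  have haeq : CKN.cknA N p q r μ σ s * (((N - σ) * p - (N - μ - p) * q) * r) =
      ((N - σ) * r - (N - s) * q) * p := by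
    rw [CKN.cknA, div_mul_cancel₀]
    positivity
  have ha0 : 0 < CKN.cknA N p q r μ σ s := by
    rw [CKN.cknA]
    exact div_pos (mul_pos (by linarith) hp0) (mul_pos hD hr0)
  have ha1 : CKN.cknA N p q r μ σ s < 1 := by
    rw [CKN.cknA, div_lt_one (mul_pos hD hr0)]
    -- After cancellation, `a < 1` is `r < p^*(s, μ)` multiplied by `q`.
    nlinarith [mul_lt_mul_of_pos_right hrs hq0]
  set a := CKN.cknA N p q r μ σ s with ha
  -- `k` solves the balance `hx`; the weight balance `hy` then follows from the formula for `a`.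
  obtain ⟨k, hk⟩ : ∃ k, k = N / a * ((1 - a) / q + a / p - 1 / r) := ⟨_, rfl⟩
  have hx : 1 / r = (1 - a) / q + a * (1 / p - k / N) := by
    rw [hk]; field_simp; ring
  -- Clearing denominators shows that `k` has the sign of the slack in `h1`; similarly `1 - k` below
  -- has the sign of the slack in `h2`.
  have hakD : a * k * (p * q * r) * ((N - σ) * p - (N - μ - p) * q) =
      N * ((r * (μ + p - σ) - (p * (s - σ) + q * (μ + p - s))) * p * q) := by
    have e : a * k * (p * q * r) = N * ((1 - a) * p * r + a * q * r - p * q) := by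
      rw [hk]; field_simp
    rw [e]
    linear_combination (N * (q - p)) * haeq
  have hk0 : 0 ≤ k := by
    have h3 : 0 ≤ k * (a * (p * q * r) * ((N - σ) * p - (N - μ - p) * q)) := by
      have h4 : 0 ≤ N * ((r * (μ + p - σ) - (p * (s - σ) + q * (μ + p - s))) * p * q) :=
        mul_nonneg hN0.le (mul_nonneg (mul_nonneg (by linarith) hp0.le) hq0.le)
      linarith
    exact nonneg_of_mul_nonneg_left h3 (by positivity)
  have hk1 : k ≤ 1 := by
    have h3 : 0 ≤ (1 - k) * (a * (p * q * r) * ((N - σ) * p - (N - μ - p) * q)) := by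
      have h4 : (1 - k) * (a * (p * q * r) * ((N - σ) * p - (N - μ - p) * q)) =
          p * q * ((N * p - N * r + p * r) * (s - σ) - (N * μ - N * s + p * s) * (r - q)) := by
        linear_combination (p * q) * haeq - hakD
      rw [h4]
      exact mul_nonneg (by positivity) (by linarith)
    have := nonneg_of_mul_nonneg_left h3 (by positivity)
    linarith
  have hy : s / r = (1 - a) * (σ / q) + a * (μ / p + 1 - k) := by
    have e : a * k = N * ((1 - a) / q + a / p - 1 / r) := by rw [hk]; field_simp
    have e2 : a * (μ / p + 1 - k) = a * (μ / p + 1) - a * k := by ring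
    rw [e2, e]
    field_simp
    linear_combination -haeq
  obtain ⟨C, hC⟩ := CKN.ckn hN hp hq0 hr0 ha0 ha1 hk0 hk1 (by linarith) (by linarith) hμ hx hy
  refine ⟨⟨ha0, ha1⟩, ⟨C + 1, by positivity, fun Ω hΩ u G hE => (hC Ω hΩ u G hE).trans ?_⟩, ?_⟩
  · have : (C : ℝ≥0∞) ≤ ENNReal.ofReal (C + 1) := by
      rw [← ENNReal.ofReal_coe_nnreal]
      exact ENNReal.ofReal_le_ofReal (by linarith)
    gcongr
  · intro _ Ω hΩ lam hlam
    -- Both norms are at most `(1 + lam⁻¹)` times the norm of `E`, and the exponents `a` and `1 - a`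
    -- add up to `1`.
    refine ⟨(C + 1) * (1 + lam⁻¹), by positivity, fun u G hE => ?_⟩
    have h := hC Ω hΩ u G hE
    obtain ⟨⟨⟨-, hG⟩, -⟩, hum, hu⟩ := hE
    have ha1' : 0 ≤ 1 - a := by linarith
    refine ⟨⟨hum, h.trans_lt ?_⟩, h.trans ?_⟩
    · exact ENNReal.mul_lt_top (ENNReal.mul_lt_top ENNReal.coe_lt_top
        (ENNReal.rpow_lt_top_of_nonneg ha0.le hG.ne)) (ENNReal.rpow_lt_top_of_nonneg ha1' hu.ne)
    · set X := CKN.weightedNorm Ω p μ G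
      set Y := CKN.weightedNorm Ω q σ u
      have hl : ENNReal.ofReal lam⁻¹ * ENNReal.ofReal lam = 1 := by
        rw [← ENNReal.ofReal_mul (by positivity), inv_mul_cancel₀ hlam.ne', ENNReal.ofReal_one]
      have hX : X ≤ ENNReal.ofReal (1 + lam⁻¹) * CKN.normE Ω p q μ σ lam u G := by
        calc X ≤ 1 * CKN.normE Ω p q μ σ lam u G := by rw [one_mul]; exact le_self_add
          _ ≤ _ := by
            gcongr
            rw [ENNReal.one_le_ofReal]
            linarith [inv_pos.2 hlam]
      have hY : Y ≤ ENNReal.ofReal (1 + lam⁻¹) * CKN.normE Ω p q μ σ lam u G := by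
        calc Y = ENNReal.ofReal lam⁻¹ * (ENNReal.ofReal lam * Y) := by rw [← mul_assoc, hl, one_mul]
          _ ≤ ENNReal.ofReal lam⁻¹ * CKN.normE Ω p q μ σ lam u G := by gcongr; exact le_add_self
          _ ≤ _ := by gcongr; linarith
      rw [mul_assoc, ENNReal.ofReal_mul (by positivity), mul_assoc]
      refine mul_le_mul' ?_ ((mul_le_mul' (ENNReal.rpow_le_rpow hX ha0.le)
        (ENNReal.rpow_le_rpow hY ha1')).trans (le_of_eq ?_))
      · rw [← ENNReal.ofReal_coe_nnreal]
        exact ENNReal.ofReal_le_ofReal (by linarith)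
      · rw [← ENNReal.rpow_add_of_nonneg _ _ ha0.le ha1', add_sub_cancel, ENNReal.rpow_one]
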